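/- Consider the $(1:b)$ random-Breaker Hamiltonicity game on the edge set $E(K_n)$ of the complete graph on $n$ vertices: in each round, Breaker first claims a uniformly random set of $b$ unclaimed edges (all unclaimed edges, if there are fewer than $b$), and then Maker claims one unclaimed edge of his choice, knowing everything that has been played so far (he claims nothing if no edge is left). Maker's goal is that the graph formed by his edges contains a Hamilton cycle. For every $\varepsilon>0$ there are integers $T(n)=(1+o(1))n$, depending only on $\varepsilon$ and $n$, such that for every $n$ and every integer $b\ge 0$ Maker has a (deterministic) strategy $S_{n,b}$ with the following property: for every sequence of integers $b(n)$ with $0\le b(n)\le(1-\varepsilon)\frac n2$ for all $n$, if Maker plays according to $S_{n,b(n)}$ in the $(1:b(n))$ game on $E(K_n)$, then with probability tending to $1$ as $n\to\infty$ his graph contains a Hamilton cycle within the first $T(n)$ rounds. -/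

import Mathlib

open Filter Topology

namespace RandomBreaker

/-- One round of a `(1 : b)` random-Breaker game on a board with elements in `E`: the set of elements
claimed by Breaker, followed by the element claimed by Maker (`none` if nothing was left to claim). -/
structure Round (E : Type*) where
  breaker : Finset E
  maker : Option E

/-- The course of the game so far, most recent round first. -/
abbrev History (E : Type*) := List (Round E)

section Game

variable {E : Type*} [DecidableEq E]

/-- The elements claimed by Maker. -/
def makerSet : History E → Finset E
  | [] => ∅
  | r :: h => r.maker.toFinset ∪ makerSet h

/-- The elements claimed by Breaker. -/
def breakerSet : History E → Finset E
  | [] => ∅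
  | r :: h => r.breaker ∪ breakerSet h

/-- The elements of the board `X` that nobody has claimed yet. -/
def unclaimed (X : Finset E) (h : History E) : Finset E :=
  X \ (makerSet h ∪ breakerSet h)

/-- A strategy of Maker on the board `X`. Given the rounds played so far and Breaker's move `B` in
the current round, it claims one element that is still unclaimed, provided that there is one. -/
structure MakerStrategy (X : Finset E) where
  move : History E → Finset E → Option E
  mem_of_move : ∀ h B e, move h B = some e → e ∈ unclaimed X h \ B
  move_isSome : ∀ h B, (unclaimed X h \ B).Nonempty → (move h B).isSome

/-- Breaker's possible moves: all sets of `b` unclaimed elements (if fewer than `b` elements are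
unclaimed, Breaker takes all of them). -/
def breakerMoves (X : Finset E) (b : ℕ) (h : History E) : Finset (Finset E) :=
  (unclaimed X h).powersetCard (min b (unclaimed X h).card)

theorem breakerMoves_nonempty (X : Finset E) (b : ℕ) (h : History E) :
    (breakerMoves X b h).Nonempty :=
  Finset.powersetCard_nonempty.2 (min_le_right _ _)

/-- One round: Breaker claims a uniformly random set of `b` unclaimed elements, then Maker answers
according to the strategy `S`. The result is the law of the new history. -/
noncomputable def playRound {X : Finset E} (b : ℕ) (S : MakerStrategy X) (h : History E) :
    PMF (History E) :=
  (PMF.uniformOfFinset (breakerMoves X b h) (breakerMoves_nonempty X b h)).map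
    fun B => ⟨B, S.move h B⟩ :: h

/-- The law of the history after `t` rounds, starting from the empty board. -/
noncomputable def play {X : Finset E} (b : ℕ) (S : MakerStrategy X) : ℕ → PMF (History E)
  | 0 => PMF.pure []
  | t + 1 => (play b S t).bind (playRound b S)

end Game

/-- The board `E(K_n)`. -/
def board (n : ℕ) : Finset (Sym2 (Fin n)) := (⊤ : SimpleGraph (Fin n)).edgeFinset

/-- Maker's graph, on the vertex set of `K_n`. -/
def makerGraph {n : ℕ} (h : History (Sym2 (Fin n))) : SimpleGraph (Fin n) :=
  SimpleGraph.fromEdgeSet (makerSet h : Set (Sym2 (Fin n)))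

/-- The probability that, in the `(1 : b)` random-Breaker game on `E(K_n)`, Maker's graph contains a
Hamilton cycle within the first `t` rounds when Maker plays according to `S`. (Maker's graph only
grows, so that it is enough to look at the graph after `t` rounds.) -/
noncomputable def hamiltonProb {n : ℕ} (b : ℕ) (S : MakerStrategy (board n)) (t : ℕ) : ENNReal :=
  (play b S t).toOuterMeasure {h | (makerGraph h).IsHamiltonian}

end RandomBreaker

/-! Maker keeps an ordering of all vertices in mind and counts its *gaps*, the consecutive pairs that
are not yet his edges. All that he needs of Breaker's final edge set `F` is that it is `Robust`: for
`k = ⌊n ^ (1/4)⌋`, some pair between any two disjoint `k`-sets of vertices lies outside `F`, and every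
vertex has more than `2 * k` neighbours outside `F`. These properties pass to subsets of `F`, so that
they hold throughout the game if they hold at its end.

Against a robust Breaker (`Winnable.exists_edge`), as long as there are at least `2 * k` gaps, two of
the vertices in front of gaps can be joined, and reversing the segment between them removes a gap
(`exists_reversal_of_mem_gaps`); this takes at most `n` rounds and wastes none. The remaining
gaps are removed by Pósa rotations: Maker raises the degrees of the two ends to `2 * k + 1`, rotates at
both ends, which yields two disjoint sets of `k` possible ends (`exists_rotated_ends`), and joins a
free pair between them. The resulting closed ordering is a Hamilton cycle, or can be cut open at a gap
(`exists_cyclic_shift`). This costs `O(k)` rounds for each of `O(k)` gaps, hence `n + O(√n)` rounds in all.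

Breaker is robust with high probability whatever Maker does. The bias is so small that a positive
proportion of the edges is unclaimed up to the end; thus Breaker takes each unclaimed edge with
probability `O(1 / n)` in each of the `O(n)` rounds, and a fixed set `A` of edges ends up entirely in
his hands with probability at most `p ^ |A|`, where `p < 1` depends only on `ε`
(`prob_subset_breakerSet_le`). A union bound over `2 * n ^ (2 * k + 1)` sets of size at least `k ^ 2`
(`exists_obstructions`) completes the proof, since `k` grows faster than `log n`. -/

namespace RandomBreaker

/-! ### Orderings of the vertices and their gaps -/

section Tours

variable {V : Type*}

open Classical in
/-- The vertices of the list `L` that are not adjacent in `G` to the vertex listed next. An ordering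
of all vertices is a Hamilton path of `G` if and only if it has no gap. -/
noncomputable def gaps (G : SimpleGraph V) : List V → List V
  | [] => []
  | [_] => []
  | a :: b :: l => if G.Adj a b then gaps G (b :: l) else a :: gaps G (b :: l)

/-- The number of consecutive pairs of `L` that are not edges of `G`. -/
noncomputable def defect (G : SimpleGraph V) (L : List V) : ℕ := (gaps G L).length

open Classical in
theorem gaps_append_cons (G : SimpleGraph V) (A : List V) (a b : V) (B : List V) :
    gaps G (A ++ a :: b :: B) =
      gaps G (A ++ [a]) ++ ((if G.Adj a b then [] else [a]) ++ gaps G (b :: B)) := by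
  induction A with
  | nil => by_cases h : G.Adj a b <;> simp [gaps, h]
  | cons c A ih =>
    cases A with
    | nil =>
      simp only [List.nil_append, List.cons_append] at ih ⊢
      by_cases h : G.Adj c a <;> simpa [gaps, h] using ih
    | cons d A =>
      simp only [List.cons_append] at ih ⊢
      by_cases h : G.Adj c d <;> simp [gaps, h, ih]

theorem gaps_sublist (G : SimpleGraph V) (L : List V) : (gaps G L).Sublist L := by
  induction L with
  | nil => simp [gaps]
  | cons a L ih =>
    cases L with
    | nil => simp [gaps]
    | cons b L =>
      by_cases h : G.Adj a b
      · simpa [gaps, h] using ih.cons a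
      · simpa [gaps, h] using ih

theorem exists_append_of_mem_gaps {G : SimpleGraph V} {L : List V} {a : V} (h : a ∈ gaps G L) :
    ∃ A b B, L = A ++ a :: b :: B ∧ ¬ G.Adj a b := by
  induction L with
  | nil => simp [gaps] at h
  | cons c L ih =>
    cases L with
    | nil => simp [gaps] at h
    | cons d L =>
      have key : a ∈ gaps G (d :: L) → ∃ A b B, c :: d :: L = A ++ a :: b :: B ∧ ¬ G.Adj a b := by
        intro h'
        obtain ⟨A, b, B, e, hab⟩ := ih h'
        exact ⟨c :: A, b, B, by simp [e], hab⟩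
      by_cases hcd : G.Adj c d
      · exact key (by simpa [gaps, hcd] using h)
      · rcases (by simpa [gaps, hcd] using h : a = c ∨ a ∈ gaps G (d :: L)) with rfl | h'
        · exact ⟨[], d, L, rfl, hcd⟩
        · exact key h'

theorem isChain_of_defect_eq_zero {G : SimpleGraph V} {L : List V} (h : defect G L = 0) :
    L.IsChain G.Adj := by
  induction L with
  | nil => simp
  | cons a L ih =>
    cases L with
    | nil => simp
    | cons b L =>
      by_cases hab : G.Adj a b
      · exact List.isChain_cons_cons.2 ⟨hab, ih (by simpa [defect, gaps, hab] using h)⟩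
      · simp [defect, gaps, hab] at h

open Classical in
theorem defect_append_cons (G : SimpleGraph V) (A : List V) (a b : V) (B : List V) :
    defect G (A ++ a :: b :: B) =
      defect G (A ++ [a]) + (if G.Adj a b then 0 else 1) + defect G (b :: B) := by
  simp only [defect, gaps_append_cons, List.length_append]
  split_ifs <;> simp [add_assoc]

theorem defect_le_length (G : SimpleGraph V) (L : List V) : defect G L ≤ L.length :=
  (gaps_sublist G L).length_le

theorem defect_mono {G G' : SimpleGraph V} (h : G ≤ G') (L : List V) :
    defect G' L ≤ defect G L := by
  induction L with
  | nil => simp [defect, gaps]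
  | cons a L ih =>
    cases L with
    | nil => simp [defect, gaps]
    | cons b L =>
      by_cases hab : G.Adj a b
      · simpa [defect, gaps, hab, h hab] using ih
      · by_cases hab' : G'.Adj a b
        · simpa [defect, gaps, hab, hab'] using ih.trans (Nat.le_succ _)
        · simpa [defect, gaps, hab, hab'] using ih

theorem defect_append (G : SimpleGraph V) (A B : List V) :
    defect G A + defect G B ≤ defect G (A ++ B) ∧
      defect G (A ++ B) ≤ defect G A + defect G B + 1 := by
  rcases List.eq_nil_or_concat A with rfl | ⟨A, a, rfl⟩
  · simp [defect, gaps]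
  cases B with
  | nil => simp [defect, gaps]
  | cons b B =>
    have := defect_append_cons G A a b B
    simp only [List.concat_eq_append, List.append_assoc, List.singleton_append]
    split_ifs at this <;> omega

theorem defect_append_of_adj {G : SimpleGraph V} {A B : List V}
    (h : ∀ a ∈ A.getLast?, ∀ b ∈ B.head?, G.Adj a b) :
    defect G (A ++ B) = defect G A + defect G B := by
  rcases List.eq_nil_or_concat A with rfl | ⟨A, a, rfl⟩
  · simp [defect, gaps]
  cases B with
  | nil => simp [defect, gaps]
  | cons b B =>
    have := defect_append_cons G A a b B
    have hab : G.Adj a b := h a (by simp) b (by simp)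
    simpa [hab] using this

theorem defect_append_of_not_adj {G : SimpleGraph V} {A B : List V} {a b : V}
    (ha : a ∈ A.getLast?) (hb : b ∈ B.head?) (h : ¬ G.Adj a b) :
    defect G (A ++ B) = defect G A + defect G B + 1 := by
  rcases List.eq_nil_or_concat A with rfl | ⟨A, a', rfl⟩
  · simp at ha
  cases B with
  | nil => simp at hb
  | cons b' B =>
    obtain rfl : a' = a := by simpa using ha
    obtain rfl : b' = b := by simpa using hb
    have := defect_append_cons G A a' b' B
    simp only [h, if_false] at this
    simp only [List.concat_eq_append, List.append_assoc, List.singleton_append]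
    omega

theorem defect_reverse (G : SimpleGraph V) (L : List V) : defect G L.reverse = defect G L := by
  induction L with
  | nil => rfl
  | cons a L ih =>
    cases L with
    | nil => rfl
    | cons b L =>
      rw [List.reverse_cons]
      have h1 : b ∈ (b :: L).reverse.getLast? := by simp
      by_cases hab : G.Adj a b
      · rw [defect_append_of_adj (by simpa using hab.symm), ih]
        simp [defect, gaps, hab]
      · rw [defect_append_of_not_adj (a := b) (b := a) h1 (by simp) (fun h => hab h.symm), ih]
        simp [defect, gaps, hab]

/-- If `a` and `b` precede two different gaps of `L`, reversing the part of `L` between the gaps makes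
`a` and `b` consecutive, at the cost of breaking only pairs that were no edges. -/
theorem exists_reversal_of_mem_gaps {G : SimpleGraph V} {L : List V} {a b : V} (hne : a ≠ b)
    (ha : a ∈ gaps G L) (hb : b ∈ gaps G L) :
    ∃ L', L'.Perm L ∧ L'.head? = L.head? ∧ L'.getLast? = L.getLast? ∧
      ∀ G', G ≤ G' → G'.Adj a b → defect G' L' < defect G L := by
  classical
  -- the case in which the gap at `a` comes first
  have key : ∀ {a b : V} {A M C : List V}, L = (A ++ [a]) ++ (M ++ C) → b ∈ M.getLast? →
      (∃ y ∈ M.head?, ¬ G.Adj a y) → (∃ z ∈ C.head?, ¬ G.Adj b z) →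
      ∃ L', L'.Perm L ∧ L'.head? = L.head? ∧ L'.getLast? = L.getLast? ∧
        ∀ G', G ≤ G' → G'.Adj a b → defect G' L' < defect G L := by
    rintro a b A M C rfl hbM ⟨y, hy, hay⟩ ⟨z, hz, hbz⟩
    have hM : M ≠ [] := by rintro rfl; simp at hy
    have hC : C ≠ [] := by rintro rfl; simp at hz
    refine ⟨(A ++ [a]) ++ (M.reverse ++ C), ?_, ?_, ?_, ?_⟩
    · exact List.Perm.append_left _ (List.Perm.append_right _ M.reverse_perm)
    · simp
    · obtain ⟨C, c, rfl⟩ := (List.eq_nil_or_concat C).resolve_left hC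
      simp only [List.concat_eq_append, ← List.append_assoc, List.getLast?_concat]
    · intro G' hG hab
      have h1 := defect_append_of_not_adj hbM hz hbz
      have h2 := defect_append_of_not_adj (G := G) (A := A ++ [a]) (B := M ++ C) (a := a) (b := y)
        (by simp) (by simp [List.head?_append, Option.mem_def.1 hy]) hay
      have h3 := (defect_append G' M.reverse C).2
      have h4 : defect G' ((A ++ [a]) ++ (M.reverse ++ C)) =
          defect G' (A ++ [a]) + defect G' (M.reverse ++ C) := by
        apply defect_append_of_adj
        simpa [List.head?_append, Option.mem_def.1 hbM] using hab
      rw [defect_reverse] at h3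
      have := defect_mono hG M
      have := defect_mono hG C
      have := defect_mono hG (A ++ [a])
      omega
  obtain ⟨A, y, C, rfl, hay⟩ := exists_append_of_mem_gaps ha
  rw [gaps_append_cons, if_neg hay] at hb
  rcases List.mem_append.1 hb with hb | hb
  · obtain ⟨A', z, C', e, hbz⟩ := exists_append_of_mem_gaps hb
    obtain ⟨L', h1, h2, h3, h4⟩ := key (a := b) (b := a) (A := A') (M := z :: C') (C := y :: C)
      (by rw [← List.singleton_append, ← List.append_assoc, e]; simp)
      (by
        have := congrArg List.getLast? e
        rw [List.getLast?_append, List.getLast?_append] at this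
        simpa [List.getLast?_cons] using this.symm)
      ⟨z, by simp, hbz⟩ ⟨y, by simp, hay⟩
    exact ⟨L', h1, h2, h3, fun G' hG hab => h4 G' hG hab.symm⟩
  · have hb : b ∈ gaps G (y :: C) := by simpa [hne.symm] using hb
    obtain ⟨A', z, C', e, hbz⟩ := exists_append_of_mem_gaps hb
    refine key (a := a) (b := b) (A := A) (M := A' ++ [b]) (C := z :: C') (by simp [e]) (by simp)
      ⟨y, ?_, hay⟩ ⟨z, by simp, hbz⟩
    have := congrArg List.head? e
    cases A' <;> simpa using this.symm

/-- Two finite sets of positions can be thinned out to about half their sizes such that one of them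
lies entirely in front of the other. -/
theorem exists_separated_subsets {k : ℕ} {S T : Finset V} (f : V → ℕ) (hf : Set.InjOn f S)
    (hS : 2 * k ≤ S.card) (hT : 2 * k ≤ T.card) :
    ∃ S' ⊆ S, ∃ T' ⊆ T, k ≤ S'.card ∧ k ≤ T'.card ∧
      ((∀ s ∈ S', ∀ t ∈ T', f s ≤ f t) ∨ ∀ s ∈ S', ∀ t ∈ T', f t < f s) := by
  classical
  have hex : ∃ m, k ≤ (S.filter fun s => f s < m).card := by
    refine ⟨S.sup f + 1, ?_⟩
    rw [Finset.filter_true_of_mem fun s hs => Nat.lt_succ_of_le (Finset.le_sup hs)]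
    omega
  set m := Nat.find hex with hm
  have h1 : k ≤ (S.filter fun s => f s < m).card := Nat.find_spec hex
  -- minimality of the threshold `m` leaves at least `k` elements of `S` from position `m` on
  have h2 : (S.filter fun s => f s < m).card ≤ k := by
    rcases Nat.eq_zero_or_pos m with h0 | h0
    · simp [h0]
    have h3 : (S.filter fun s => f s < m - 1).card < k :=
      not_le.1 (Nat.find_min hex (by omega : m - 1 < m))
    have h4 : (S.filter fun s => f s < m) ⊆
        (S.filter fun s => f s < m - 1) ∪ S.filter fun s => f s = m - 1 := by
      intro s hs
      simp only [Finset.mem_filter, Finset.mem_union] at hs ⊢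
      have := hs.1
      by_cases h : f s < m - 1
      · exact Or.inl ⟨this, h⟩
      · exact Or.inr ⟨this, by omega⟩
    have h5 : (S.filter fun s => f s = m - 1).card ≤ 1 := by
      rw [Finset.card_le_one]
      intro s hs t ht
      simp only [Finset.mem_filter] at hs ht
      exact hf hs.1 ht.1 (hs.2.trans ht.2.symm)
    have := (Finset.card_le_card h4).trans (Finset.card_union_le _ _)
    omega
  have h3 := S.card_filter_add_card_filter_not (fun s => f s < m)
  have h4 := T.card_filter_add_card_filter_not (fun s => f s < m)
  by_cases h5 : k ≤ (T.filter fun t => ¬ f t < m).card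
  · refine ⟨_, S.filter_subset _, _, T.filter_subset _, h1, h5, Or.inl fun s hs t ht => ?_⟩
    simp only [Finset.mem_filter] at hs ht
    omega
  · refine ⟨S.filter fun s => ¬ f s < m, S.filter_subset _, T.filter fun t => f t < m,
      T.filter_subset _, by omega, by omega, Or.inr fun s hs t ht => ?_⟩
    simp only [Finset.mem_filter] at hs ht
    omega

/-- Rotations at both ends. From an ordering `L` with first vertex `x` and last vertex `y`, neighbours
`s` of `x` and `t` of `y` give an ordering without additional gaps whose ends are neighbours of `s` and
`t` in `L`. Which neighbours these are depends on the order of `s` and `t` in `L`, so that the sets are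
separated first. -/
theorem exists_rotated_ends [DecidableEq V] {G : SimpleGraph V} {L : List V} (hL : L.Nodup)
    {x y : V} (hx : L.head? = some x) (hy : L.getLast? = some y) {k : ℕ} {S T : Finset V}
    (hSL : ∀ s ∈ S, s ∈ L) (hTL : ∀ t ∈ T, t ∈ L)
    (hSx : ∀ s ∈ S, G.Adj x s) (hTy : ∀ t ∈ T, G.Adj y t) (hxT : x ∉ T)
    (hS : 2 * k ≤ S.card) (hT : 2 * k ≤ T.card) :
    ∃ P Q : Finset V, k ≤ P.card ∧ k ≤ Q.card ∧ Disjoint P Q ∧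
      ∀ p ∈ P, ∀ q ∈ Q, ∃ L', L'.Perm L ∧ L'.head? = some p ∧ L'.getLast? = some q ∧
        defect G L' ≤ defect G L := by
  obtain ⟨S, hS', T, hT', hSk, hTk, hST⟩ := exists_separated_subsets (L.idxOf ·)
    (fun s hs t ht h => (List.idxOf_inj (hSL s hs)).1 h) hS hT
  have hne : L ≠ [] := by rintro rfl; simp at hx
  have hn : 0 < L.length := List.length_pos_iff.2 hne
  have hx0 : L[0]? = some x := by rw [← hx, List.head?_eq_getElem?]
  have hy0 : L[L.length - 1]? = some y := by rw [← hy, List.getLast?_eq_getElem?]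
  -- positions of the elements of `S` and `T`
  have pos : ∀ v ∈ L, L.idxOf v < L.length ∧ L[L.idxOf v]? = some v := fun v hv =>
    ⟨List.idxOf_lt_length_iff.2 hv, by
      rw [List.getElem?_eq_getElem (List.idxOf_lt_length_iff.2 hv), List.getElem_idxOf]⟩
  have posS : ∀ s ∈ S, 0 < L.idxOf s := by
    intro s hs
    rcases Nat.eq_zero_or_pos (L.idxOf s) with h | h
    · have := (pos s (hSL s (hS' hs))).2
      rw [h, hx0] at this
      exact absurd (hSx s (hS' hs)) (by simp [Option.some.inj this])
    · exact h
  have posT : ∀ t ∈ T, 0 < L.idxOf t ∧ L.idxOf t + 1 < L.length := by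
    intro t ht
    have h2 := pos t (hTL t (hT' ht))
    constructor
    · rcases Nat.eq_zero_or_pos (L.idxOf t) with h | h
      · have := h2.2
        rw [h, hx0] at this
        exact absurd (hT' ht) (by simpa [← Option.some.inj this] using hxT)
      · exact h
    · by_contra h
      have := h2.2
      rw [show L.idxOf t = L.length - 1 by omega, hy0] at this
      exact absurd (hTy t (hT' ht)) (by simp [Option.some.inj this])
  have ginj : ∀ i j, i < L.length → j < L.length → L.getD i x = L.getD j x → i = j := by
    intro i j hi hj h
    rw [List.getD_eq_getElem _ _ hi, List.getD_eq_getElem _ _ hj] at h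
    exact (hL.getElem_inj_iff).1 h
  have gsome : ∀ i, i < L.length → L[i]? = some (L.getD i x) := by
    intro i hi
    rw [List.getD_eq_getElem _ _ hi, List.getElem?_eq_getElem hi]
  have cardS : ∀ S : Finset V, (∀ s ∈ S, s ∈ L) → ∀ φ : ℕ → ℕ,
      (∀ s ∈ S, φ (L.idxOf s) < L.length) →
      (∀ s ∈ S, ∀ t ∈ S, φ (L.idxOf s) = φ (L.idxOf t) → L.idxOf s = L.idxOf t) →
      (S.image fun s => L.getD (φ (L.idxOf s)) x).card = S.card := by
    intro S hS φ h1 h2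
    refine Finset.card_image_of_injOn fun s hs t ht h => ?_
    exact (List.idxOf_inj (hS s hs)).1 (h2 s hs t ht (ginj _ _ (h1 s hs) (h1 t ht) h))
  have SL : ∀ s ∈ S, s ∈ L := fun s hs => hSL s (hS' hs)
  have TL : ∀ t ∈ T, t ∈ L := fun t ht => hTL t (hT' ht)
  rcases hST with hST | hST
  · refine ⟨S.image fun s => L.getD (L.idxOf s - 1) x, T.image fun t => L.getD (L.idxOf t + 1) x,
      ?_, ?_, ?_, ?_⟩
    · rwa [cardS S SL (fun i => i - 1) (fun s hs => by have := pos s (SL s hs); omega)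
        (fun s hs t ht h => by have := posS s hs; have := posS t ht; omega)]
    · rwa [cardS T TL (fun i => i + 1) (fun t ht => (posT t ht).2) (fun s hs t ht h => by omega)]
    · rw [Finset.disjoint_left]
      intro v hv hv'
      simp only [Finset.mem_image] at hv hv'
      obtain ⟨s, hs, rfl⟩ := hv
      obtain ⟨t, ht, e⟩ := hv'
      have := hST s hs t ht
      have := ginj _ _ (posT t ht).2 (by have := (pos s (SL s hs)).1; omega) e
      omega
    · intro p hp q hq
      simp only [Finset.mem_image] at hp hq
      obtain ⟨s, hs, rfl⟩ := hp
      obtain ⟨t, ht, rfl⟩ := hq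
      have hst := hST s hs t ht
      have hs1 := posS s hs
      have ht1 := posT t ht
      have hs2 := pos s (SL s hs)
      have ht2 := pos t (TL t ht)
      have hsx := hSx s (hS' hs)
      have hty := hTy t (hT' ht)
      have hps := gsome (L.idxOf s - 1) (by omega)
      have hqt := gsome (L.idxOf t + 1) (by omega)
      generalize L.getD (L.idxOf s - 1) x = p at hps ⊢
      generalize L.getD (L.idxOf t + 1) x = q at hqt ⊢
      generalize L.idxOf s = i at *
      generalize L.idxOf t = j at *
      -- `x ⋯ p | s ⋯ t | q ⋯ y` becomes `p ⋯ x | s ⋯ t | y ⋯ q`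
      obtain ⟨A, B, C, e, hA, hA', hB, hB', hC, hC'⟩ : ∃ A B C, L = A ++ (B ++ C) ∧
          A.head? = some x ∧ A.getLast? = some p ∧ B.head? = some s ∧ B.getLast? = some t ∧
          C.head? = some q ∧ C.getLast? = some y := by
        refine ⟨L.take i, (L.take (j + 1)).drop i, L.drop (j + 1), ?_, ?_, ?_, ?_, ?_, ?_, ?_⟩
        · conv_lhs => rw [← List.take_append_drop (j + 1) L,
            ← List.take_append_drop i (L.take (j + 1))]
          rw [List.append_assoc, List.take_take, min_eq_left (by omega)]
        · rw [List.head?_take, if_neg (by omega), hx]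
        · rw [List.getLast?_take, if_neg (by omega), hps]; rfl
        · rw [List.head?_drop, List.getElem?_take_of_lt (by omega), hs2.2]
        · rw [List.getLast?_drop, if_neg (by rw [List.length_take]; omega), List.getLast?_take,
            if_neg (by omega), Nat.add_sub_cancel, ht2.2]; rfl
        · rw [List.head?_drop, hqt]
        · rw [List.getLast?_drop, if_neg (by omega), hy]
      refine ⟨A.reverse ++ (B ++ C.reverse), ?_, ?_, ?_, ?_⟩
      · rw [e]
        exact A.reverse_perm.append (C.reverse_perm.append_left B)
      · simp [List.head?_append, hA']
      · simp [List.getLast?_append, hC]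
      · rw [defect_append_of_adj (by simpa [List.head?_append, hA, hB] using hsx),
          defect_append_of_adj (by simpa [hB', hC'] using hty.symm), defect_reverse,
          defect_reverse, e]
        have := (defect_append G A (B ++ C)).1
        have := (defect_append G B C).1
        omega
  · refine ⟨S.image fun s => L.getD (L.idxOf s - 1) x, T.image fun t => L.getD (L.idxOf t - 1) x,
      ?_, ?_, ?_, ?_⟩
    · rwa [cardS S SL (fun i => i - 1) (fun s hs => by have := pos s (SL s hs); omega)
        (fun s hs t ht h => by have := posS s hs; have := posS t ht; omega)]
    · rwa [cardS T TL (fun i => i - 1) (fun s hs => by have := pos s (TL s hs); omega)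
        (fun s hs t ht h => by have := posT s hs; have := posT t ht; omega)]
    · rw [Finset.disjoint_left]
      intro v hv hv'
      simp only [Finset.mem_image] at hv hv'
      obtain ⟨s, hs, rfl⟩ := hv
      obtain ⟨t, ht, e⟩ := hv'
      have := hST s hs t ht
      have := posT t ht
      have := ginj _ _ (by omega) (by have := (pos s (SL s hs)).1; omega) e
      omega
    · intro p hp q hq
      simp only [Finset.mem_image] at hp hq
      obtain ⟨s, hs, rfl⟩ := hp
      obtain ⟨t, ht, rfl⟩ := hq
      have hst := hST s hs t ht
      have hs1 := posS s hs
      have ht1 := posT t ht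
      have hs2 := pos s (SL s hs)
      have ht2 := pos t (TL t ht)
      have hsx := hSx s (hS' hs)
      have hty := hTy t (hT' ht)
      have hps := gsome (L.idxOf s - 1) (by omega)
      have hqt := gsome (L.idxOf t - 1) (by omega)
      generalize L.getD (L.idxOf s - 1) x = p at hps ⊢
      generalize L.getD (L.idxOf t - 1) x = q at hqt ⊢
      generalize L.idxOf s = i at *
      generalize L.idxOf t = j at *
      -- `x ⋯ q | t ⋯ p | s ⋯ y` becomes `p ⋯ t | y ⋯ s | x ⋯ q`
      obtain ⟨A, B, C, e, hA, hA', hB, hB', hC, hC'⟩ : ∃ A B C, L = A ++ (B ++ C) ∧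
          A.head? = some x ∧ A.getLast? = some q ∧ B.head? = some t ∧ B.getLast? = some p ∧
          C.head? = some s ∧ C.getLast? = some y := by
        refine ⟨L.take j, (L.take i).drop j, L.drop i, ?_, ?_, ?_, ?_, ?_, ?_, ?_⟩
        · conv_lhs => rw [← List.take_append_drop i L,
            ← List.take_append_drop j (L.take i)]
          rw [List.append_assoc, List.take_take, min_eq_left (by omega)]
        · rw [List.head?_take, if_neg (by omega), hx]
        · rw [List.getLast?_take, if_neg (by omega), hqt]; rfl
        · rw [List.head?_drop, List.getElem?_take_of_lt (by omega), ht2.2]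
        · rw [List.getLast?_drop, if_neg (by rw [List.length_take]; omega), List.getLast?_take,
            if_neg (by omega), hps]; rfl
        · rw [List.head?_drop, hs2.2]
        · rw [List.getLast?_drop, if_neg (by omega), hy]
      refine ⟨B.reverse ++ (C.reverse ++ A), ?_, ?_, ?_, ?_⟩
      · rw [e]
        refine (B.reverse_perm.append (C.reverse_perm.append_right A)).trans ?_
        rw [← List.append_assoc]
        exact List.perm_append_comm
      · simp [List.head?_append, hB']
      · simp [List.getLast?_append, hA']
      · rw [defect_append_of_adj (by simpa [List.head?_append, hB, hC'] using hty.symm),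
          defect_append_of_adj (by simpa [hA, hC] using hsx.symm), defect_reverse,
          defect_reverse, e]
        have := (defect_append G A (B ++ C)).1
        have := (defect_append G B C).1
        omega

theorem isHamiltonian_of_defect_eq_zero [Fintype V] [DecidableEq V] {G : SimpleGraph V}
    {L : List V} (hL : L.Nodup) (hV : ∀ v, v ∈ L) (h3 : 3 ≤ L.length) {p q : V}
    (hp : L.head? = some p) (hq : L.getLast? = some q) (hqp : G.Adj q p) (h0 : defect G L = 0) :
    G.IsHamiltonian := by
  intro _
  have hne : L ≠ [] := by rintro rfl; simp at hp
  have hc := isChain_of_defect_eq_zero h0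
  have hp' : L.head hne = p := by rwa [List.head?_eq_some_head hne, Option.some.injEq] at hp
  have hq' : L.getLast hne = q := by
    rwa [List.getLast?_eq_some_getLast hne, Option.some.injEq] at hq
  subst hp' hq'
  have hs := SimpleGraph.Walk.support_ofSupport hne hc
  have hlen := congrArg List.length hs
  rw [SimpleGraph.Walk.length_support] at hlen
  refine ⟨_, SimpleGraph.Walk.cons hqp (SimpleGraph.Walk.ofSupport L hne hc), ?_⟩
  rw [SimpleGraph.Walk.isHamiltonianCycle_iff_isCycle_and_support_count_tail_eq_one]
  constructor
  · rw [SimpleGraph.Walk.isCycle_iff_isPath_tail_and_le_length]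
    constructor
    · rw [SimpleGraph.Walk.isPath_def, SimpleGraph.Walk.support_tail_of_not_nil _ (by simp)]
      simpa [hs] using hL
    · rw [SimpleGraph.Walk.length_cons]
      omega
  · intro v
    simpa [hs] using List.count_eq_one_of_mem hL (hV v)

/-- A closed ordering that has a gap can be cut open at the gap, which then no longer counts. -/
theorem exists_cyclic_shift {G : SimpleGraph V} {L : List V} {p q : V}
    (hp : L.head? = some p) (hq : L.getLast? = some q) (hqp : G.Adj q p) (h0 : defect G L ≠ 0) :
    ∃ L', L'.Perm L ∧ defect G L' < defect G L := by
  obtain ⟨a, ha⟩ := List.exists_mem_of_length_pos (Nat.pos_of_ne_zero h0)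
  obtain ⟨A, b, B, rfl, hab⟩ := exists_append_of_mem_gaps ha
  have hperm : ((b :: B) ++ (A ++ [a])).Perm ((A ++ [a]) ++ b :: B) := List.perm_append_comm
  refine ⟨(b :: B) ++ (A ++ [a]), by simpa using hperm, ?_⟩
  rw [defect_append_cons, if_neg hab, defect_append_of_adj]
  · omega
  · intro u hu v hv
    obtain rfl : u = q := by
      rw [List.getLast?_append_of_ne_nil _ (by simp), List.getLast?_cons_cons] at hq
      exact Option.some.inj ((Option.mem_def.1 hu).symm.trans hq)
    obtain rfl : v = p := by
      cases A <;> simp_all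
    exact hqp

end Tours

/-! ### Maker's strategy -/

section Strategy

variable {V : Type*}

/-- The graph with the edges in `M`. -/
abbrev edgeGraph (M : Finset (Sym2 V)) : SimpleGraph V := SimpleGraph.fromEdgeSet (M : Set (Sym2 V))

theorem edgeGraph_mono {M M' : Finset (Sym2 V)} (h : M ⊆ M') : edgeGraph M ≤ edgeGraph M' :=
  SimpleGraph.fromEdgeSet_mono (by exact_mod_cast h)

theorem ncard_neighborSet_mono [Finite V] {G G' : SimpleGraph V} (h : G ≤ G') (v : V) :
    (G.neighborSet v).ncard ≤ (G'.neighborSet v).ncard :=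
  Set.ncard_le_ncard (fun _ hw => h hw) (Set.toFinite _)

variable [Fintype V] [DecidableEq V]

/-- What Maker needs to know about the set `F` of Breaker's edges: outside `F` there is an edge between
any two disjoint sets of `k` vertices, and every vertex has at least `2 * k + 1` neighbours. -/
def Robust (k : ℕ) (F : Finset (Sym2 V)) : Prop :=
  (∀ X Y : Finset V, k ≤ X.card → k ≤ Y.card → Disjoint X Y → ∃ x ∈ X, ∃ y ∈ Y, s(x, y) ∉ F) ∧
    ∀ v : V, 2 * k + 1 ≤ (Finset.univ.filter fun w => w ≠ v ∧ s(v, w) ∉ F).card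

theorem Robust.anti {k : ℕ} {F F' : Finset (Sym2 V)} (h : F ⊆ F') (hF : Robust k F') :
    Robust k F := by
  refine ⟨fun X Y hX hY hXY => ?_, fun v => (hF.2 v).trans (Finset.card_le_card ?_)⟩
  · obtain ⟨x, hx, y, hy, hxy⟩ := hF.1 X Y hX hY hXY
    exact ⟨x, hx, y, hy, fun h' => hxy (h h')⟩
  · exact Finset.monotone_filter_right _ fun w _ hw => ⟨hw.1, fun h' => hw.2 (h h')⟩

/-- An upper bound for the number of rounds in which an ordering with `d` gaps whose ends have degrees
`p` and `q` is turned into a Hamilton cycle: as long as there are at least `2 * k` gaps, removing one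
takes a single round. Later it takes `4 * k + 3`: at most `4 * k + 2` to raise the degrees of both ends
to `2 * k + 1`, and one to close the ordering. The same has to be done once more when there is no gap
left, for which the last three summands account. -/
def cost (k d p q : ℕ) : ℕ :=
  (4 * k + 3) * min d (2 * k) + (d - 2 * k) + (2 * k + 1 - p) + (2 * k + 1 - q) + 1

theorem cost_mono {k d d' p p' q q' : ℕ} (hd : d ≤ d') (hp : p' ≤ p) (hq : q' ≤ q) :
    cost k d p q ≤ cost k d' p' q' := by
  have : (4 * k + 3) * min d (2 * k) ≤ (4 * k + 3) * min d' (2 * k) :=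
    Nat.mul_le_mul_left _ (by omega)
  unfold cost
  omega

theorem cost_lt_of_defect_lt {k d d' p p' q q' : ℕ} (hd : d < d') (hp : p' ≤ p) (hq : q' ≤ q) :
    cost k d p q < cost k d' p' q' := by
  have h1 : (4 * k + 3) * min d (2 * k) ≤ (4 * k + 3) * min d' (2 * k) :=
    Nat.mul_le_mul_left _ (by omega)
  unfold cost
  rcases lt_or_ge d (2 * k) with h | h
  · have h2 : (4 * k + 3) * (min d (2 * k) + 1) ≤ (4 * k + 3) * min d' (2 * k) :=
      Nat.mul_le_mul_left _ (by omega)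
    rw [mul_add, mul_one] at h2
    omega
  · omega

/-- Removing one of at most `2 * k` gaps pays for raising the degrees of two new ends. -/
theorem cost_lt_of_few_gaps {k d d' p p' q q' : ℕ} (hd : d < d') (hd' : d' ≤ 2 * k) :
    cost k d p q < cost k d' p' q' := by
  have h2 : (4 * k + 3) * (d + 1) ≤ (4 * k + 3) * d' := Nat.mul_le_mul_left _ (by omega)
  unfold cost
  rw [min_eq_left (by omega), min_eq_left hd']
  rw [mul_add, mul_one] at h2
  omega

/-- Maker's graph `G` is Hamiltonian, or some ordering of the vertices shows that, against a robust
Breaker, at most `r` further rounds make it so. -/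
def Winnable (k : ℕ) (G : SimpleGraph V) (r : ℕ) : Prop :=
  G.IsHamiltonian ∨ ∃ (L : List V) (x y : V), L.Nodup ∧ (∀ v, v ∈ L) ∧ L.head? = some x ∧
    L.getLast? = some y ∧ cost k (defect G L) (G.neighborSet x).ncard (G.neighborSet y).ncard ≤ r

theorem Winnable.mono {k : ℕ} {G : SimpleGraph V} {r r' : ℕ} (hr : r ≤ r') (h : Winnable k G r) :
    Winnable k G r' := by
  rcases h with h | ⟨L, x, y, h1, h2, h3, h4, h5⟩
  · exact Or.inl h
  · exact Or.inr ⟨L, x, y, h1, h2, h3, h4, h5.trans hr⟩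

theorem Winnable.isHamiltonian {k : ℕ} {G : SimpleGraph V} (h : Winnable k G 0) :
    G.IsHamiltonian := by
  rcases h with h | ⟨L, x, y, -, -, -, -, h5⟩
  · exact h
  · unfold cost at h5
    omega

theorem winnable_start {k : ℕ} (G : SimpleGraph V) (h : 0 < Fintype.card V) :
    Winnable k G (Fintype.card V + (4 * k + 3) * (2 * k) + (4 * k + 3)) := by
  have hlen : (Finset.univ : Finset V).toList.length = Fintype.card V := by simp
  have hne : (Finset.univ : Finset V).toList ≠ [] := by
    intro h'
    simp [h'] at hlen
    omega
  refine Or.inr ⟨(Finset.univ : Finset V).toList, _, _, Finset.nodup_toList _, by simp,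
    List.head?_eq_some_head hne, List.getLast?_eq_some_getLast hne, ?_⟩
  have h1 := defect_le_length G (Finset.univ : Finset V).toList
  have h2 : (4 * k + 3) * min (defect G (Finset.univ : Finset V).toList) (2 * k) ≤
      (4 * k + 3) * (2 * k) := Nat.mul_le_mul_left _ (by omega)
  unfold cost
  omega

theorem exists_edge_raising_degree {k : ℕ} {M F : Finset (Sym2 V)} (hF : Robust k F) {v : V}
    (hv : ((edgeGraph M).neighborSet v).ncard < 2 * k + 1) :
    ∃ e : Sym2 V, ¬ e.IsDiag ∧ e ∉ F ∧
      ((edgeGraph M).neighborSet v).ncard < ((edgeGraph (insert e M)).neighborSet v).ncard := by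
  obtain ⟨w, hw, hw'⟩ : ∃ w ∈ Finset.univ.filter fun w => w ≠ v ∧ s(v, w) ∉ F,
      w ∉ (edgeGraph M).neighborSet v := by
    by_contra! h
    have := Set.ncard_le_ncard (s := ((Finset.univ.filter fun w => w ≠ v ∧ s(v, w) ∉ F : Finset V) :
      Set V)) (t := (edgeGraph M).neighborSet v) (fun w hw => h w (by exact_mod_cast hw))
      (Set.toFinite _)
    rw [Set.ncard_coe_finset] at this
    have := hF.2 v
    omega
  simp only [Finset.mem_filter, Finset.mem_univ, true_and] at hw
  refine ⟨s(v, w), by simpa using hw.1.symm, hw.2, ?_⟩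
  refine Set.ncard_lt_ncard ⟨fun u hu => edgeGraph_mono (Finset.subset_insert _ _) hu, fun h => ?_⟩
    (Set.toFinite _)
  refine hw' (h ?_)
  simp [hw.1.symm]

/-- The heart of the strategy: if Breaker's edges are robust, then Maker has an edge that nobody has
claimed and that brings him closer to a Hamilton cycle. -/
theorem Winnable.exists_edge {k : ℕ} {M F : Finset (Sym2 V)} (hF : Robust k F)
    (h3 : 3 ≤ Fintype.card V) {r : ℕ} (hW : Winnable k (edgeGraph M) r)
    (hH : ¬ (edgeGraph M).IsHamiltonian) :
    ∃ e : Sym2 V, ¬ e.IsDiag ∧ e ∉ M ∧ e ∉ F ∧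
      ∃ r' < r, Winnable k (edgeGraph (insert e M)) r' := by
  classical
  induction r using Nat.strong_induction_on with
  | _ r ih =>
  -- an improving edge that Maker owns already improves the bound for his present graph
  suffices h : ∃ e : Sym2 V, ¬ e.IsDiag ∧ e ∉ F ∧
      ∃ r' < r, Winnable k (edgeGraph (insert e M)) r' by
    obtain ⟨e, he, heF, r', hr', hW'⟩ := h
    by_cases heM : e ∈ M
    · rw [Finset.insert_eq_of_mem heM] at hW'
      obtain ⟨e, he, heM, heF, r'', hr'', hW''⟩ := ih r' hr' hW'
      exact ⟨e, he, heM, heF, r'', hr''.trans hr', hW''⟩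
    · exact ⟨e, he, heM, heF, r', hr', hW'⟩
  obtain ⟨L, x, y, hL, hV, hx, hy, hc⟩ := hW.resolve_left hH
  have hG : ∀ e, edgeGraph M ≤ edgeGraph (insert e M) := fun e =>
    edgeGraph_mono (Finset.subset_insert _ _)
  have hadj : ∀ {a b : V}, a ≠ b → (edgeGraph (insert s(a, b) M)).Adj a b := fun h => by
    simp [h]
  rcases le_or_gt (2 * k) (defect (edgeGraph M) L) with hd | hd
  · -- two of the vertices in front of gaps can be joined
    have hcard : (gaps (edgeGraph M) L).toFinset.card = defect (edgeGraph M) L :=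
      List.toFinset_card_of_nodup ((gaps_sublist _ L).nodup hL)
    obtain ⟨X, hX, hXk⟩ := Finset.exists_subset_card_eq
      (show k ≤ (gaps (edgeGraph M) L).toFinset.card by omega)
    obtain ⟨a, ha, b, hb, hab⟩ := hF.1 X ((gaps (edgeGraph M) L).toFinset \ X) hXk.ge
      (by rw [Finset.card_sdiff_of_subset hX]; omega) Finset.disjoint_sdiff
    have hne : a ≠ b := by
      rintro rfl
      exact (Finset.mem_sdiff.1 hb).2 ha
    obtain ⟨L', hp, hh, hl, hlt⟩ := exists_reversal_of_mem_gaps hne (List.mem_toFinset.1 (hX ha))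
      (List.mem_toFinset.1 (Finset.mem_sdiff.1 hb).1)
    refine ⟨s(a, b), by simpa using hne, hab, _, lt_of_lt_of_le (cost_lt_of_defect_lt
      (hlt _ (hG s(a, b)) (hadj hne)) (ncard_neighborSet_mono (hG s(a, b)) x)
      (ncard_neighborSet_mono (hG s(a, b)) y)) hc,
      Or.inr ⟨L', x, y, hp.nodup_iff.2 hL, fun v => hp.mem_iff.2 (hV v), hh.trans hx, hl.trans hy,
        le_rfl⟩⟩
  rcases lt_or_ge ((edgeGraph M).neighborSet x).ncard (2 * k + 1) with hdx | hdx
  · obtain ⟨e, he, heF, hlt⟩ := exists_edge_raising_degree hF hdx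
    refine ⟨e, he, heF, _, lt_of_lt_of_le ?_ hc, Or.inr ⟨L, x, y, hL, hV, hx, hy, le_rfl⟩⟩
    refine lt_of_le_of_lt (cost_mono (defect_mono (hG e) L) le_rfl
      (ncard_neighborSet_mono (hG e) y)) ?_
    unfold cost
    omega
  rcases lt_or_ge ((edgeGraph M).neighborSet y).ncard (2 * k + 1) with hdy | hdy
  · obtain ⟨e, he, heF, hlt⟩ := exists_edge_raising_degree hF hdy
    refine ⟨e, he, heF, _, lt_of_lt_of_le ?_ hc, Or.inr ⟨L, x, y, hL, hV, hx, hy, le_rfl⟩⟩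
    refine lt_of_le_of_lt (cost_mono (defect_mono (hG e) L) (ncard_neighborSet_mono (hG e) x)
      le_rfl) ?_
    unfold cost
    omega
  -- both ends have large degree: rotate at both of them and close the cycle
  have hS : ∀ v, ((edgeGraph M).neighborSet v).toFinset.card =
      ((edgeGraph M).neighborSet v).ncard := fun v => (Set.ncard_eq_toFinset_card' _).symm
  obtain ⟨P, Q, hP, hQ, hPQ, hrot⟩ := exists_rotated_ends (G := edgeGraph M) (k := k) hL hx hy
    (S := ((edgeGraph M).neighborSet x).toFinset)
    (T := ((edgeGraph M).neighborSet y).toFinset.erase x) (fun s _ => hV s) (fun t _ => hV t)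
    (fun s hs => by simpa using hs) (fun t ht => by simpa using (Finset.mem_erase.1 ht).2)
    (by simp) (by rw [hS]; omega)
    (by
      have := Finset.pred_card_le_card_erase (s := ((edgeGraph M).neighborSet y).toFinset) (a := x)
      rw [hS] at this
      omega)
  obtain ⟨p, hp, q, hq, hpq⟩ := hF.1 P Q hP hQ hPQ
  have hne : q ≠ p := by
    rintro rfl
    exact Finset.disjoint_left.1 hPQ hp hq
  obtain ⟨L', hperm, hh, hl, hle⟩ := hrot p hp q hq
  have hL' : L'.Nodup := hperm.nodup_iff.2 hL
  have hV' : ∀ v, v ∈ L' := fun v => hperm.mem_iff.2 (hV v)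
  have hlen : 3 ≤ L'.length := by
    rw [← List.toFinset_card_of_nodup hL', show L'.toFinset = Finset.univ by
      ext v; simp [hV' v], Finset.card_univ]
    exact h3
  refine ⟨s(q, p), by simpa using hne, by rwa [Sym2.eq_swap], ?_⟩
  have hd' := (defect_mono (hG s(q, p)) L').trans hle
  by_cases h0 : defect (edgeGraph (insert s(q, p) M)) L' = 0
  · refine ⟨0, lt_of_lt_of_le ?_ hc, Or.inl (isHamiltonian_of_defect_eq_zero hL' hV' hlen hh hl
      (hadj hne) h0)⟩
    unfold cost
    omega
  · obtain ⟨L'', hperm', hlt⟩ := exists_cyclic_shift hh hl (hadj hne) h0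
    have hne' : L'' ≠ [] := by
      rintro rfl
      have := hperm'.length_eq
      rw [List.length_nil] at this
      omega
    exact ⟨_, lt_of_lt_of_le (cost_lt_of_few_gaps (hlt.trans_le hd') hd.le) hc,
      Or.inr ⟨L'', _, _, hperm'.nodup_iff.2 hL', fun v => hperm'.mem_iff.2 (hV' v),
        List.head?_eq_some_head hne', List.getLast?_eq_some_getLast hne', le_rfl⟩⟩

end Strategy

/-- The number of rounds that Maker needs against a robust Breaker. -/
def budget (n k : ℕ) : ℕ := n + (4 * k + 3) * (2 * k) + (4 * k + 3)

open Classical in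
/-- Maker's strategy: he claims an edge after which his graph is winnable in the rounds that then remain
of the budget, and an arbitrary edge if there is no such edge. -/
noncomputable def hamiltonStrategy (n k : ℕ) : MakerStrategy (board n) where
  move h B :=
    if hw : ∃ e ∈ unclaimed (board n) h \ B,
        Winnable k (edgeGraph (insert e (makerSet h))) (budget n k - 1 - h.length) then
      some hw.choose
    else if hne : (unclaimed (board n) h \ B).Nonempty then some hne.choose
    else none
  mem_of_move h B e he := by
    split_ifs at he with hw hne
    · exact Option.some.inj he ▸ hw.choose_spec.1
    · exact Option.some.inj he ▸ hne.choose_spec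
  move_isSome h B hne := by
    split_ifs <;> rfl

theorem mem_support_play_succ {E : Type*} [DecidableEq E] {X : Finset E} {b t : ℕ}
    {S : MakerStrategy X} {h' : History E} (hh : h' ∈ (play b S (t + 1)).support) :
    ∃ h ∈ (play b S t).support, ∃ B ∈ breakerMoves X b h, h' = ⟨B, S.move h B⟩ :: h := by
  rw [play, PMF.mem_support_bind_iff] at hh
  obtain ⟨h, hh, hh'⟩ := hh
  rw [playRound, PMF.mem_support_map_iff] at hh'
  obtain ⟨B, hB, e⟩ := hh'
  exact ⟨h, hh, B, (PMF.mem_support_uniformOfFinset_iff _ _).1 hB, e.symm⟩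

theorem winnable_of_robust {n k b t : ℕ} (h3 : 3 ≤ n) {h : History (Sym2 (Fin n))}
    (hh : h ∈ (play b (hamiltonStrategy n k) t).support) (ht : t ≤ budget n k)
    (hR : Robust k (breakerSet h)) :
    h.length = t ∧ Winnable k (edgeGraph (makerSet h)) (budget n k - t) := by
  induction t generalizing h with
  | zero =>
    rw [play, PMF.mem_support_pure_iff] at hh
    subst hh
    have := winnable_start (V := Fin n) (k := k) (edgeGraph (makerSet [])) (by simp; omega)
    rw [Fintype.card_fin] at this
    exact ⟨rfl, this⟩
  | succ t ih =>
    obtain ⟨h, hh₀, B, hB, rfl⟩ := mem_support_play_succ hh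
    obtain ⟨hlen, hW⟩ := ih hh₀ (by omega) (hR.anti Finset.subset_union_right)
    refine ⟨by simp [hlen], ?_⟩
    by_cases hH : (edgeGraph (makerSet h)).IsHamiltonian
    · exact Or.inl (hH.mono (edgeGraph_mono Finset.subset_union_right))
    obtain ⟨e, he, heM, heF, r', hr', hW'⟩ := hW.exists_edge hR (by simpa using h3) hH
    have hF : e ∉ B ∧ e ∉ breakerSet h := by
      simpa [breakerSet] using heF
    have hw : ∃ e ∈ unclaimed (board n) h \ B,
        Winnable k (edgeGraph (insert e (makerSet h))) (budget n k - 1 - h.length) := by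
      refine ⟨e, ?_, hW'.mono (by omega)⟩
      simp [unclaimed, board, he, heM, hF.1, hF.2]
    have hmove : (hamiltonStrategy n k).move h B = some hw.choose := dif_pos hw
    have := hw.choose_spec.2
    rw [hmove]
    simp only [makerSet, Option.toFinset_some]
    rw [← Finset.insert_eq]
    exact this.mono (by omega)

theorem isHamiltonian_of_robust {n k b : ℕ} (h3 : 3 ≤ n) {h : History (Sym2 (Fin n))}
    (hh : h ∈ (play b (hamiltonStrategy n k) (budget n k)).support)
    (hR : Robust k (breakerSet h)) : (makerGraph h).IsHamiltonian := by
  have := (winnable_of_robust h3 hh le_rfl hR).2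
  rw [Nat.sub_self] at this
  exact this.isHamiltonian

/-! ### The probability that Breaker claims a given set -/

section Probability

variable {E : Type*} [DecidableEq E]

theorem choose_sub_le_pow_mul_choose {u b : ℕ} (hbu : b ≤ u) {π : ℝ} (hπ : (b : ℝ) ≤ π * u)
    {r : ℕ} (hr : r ≤ b) : ((u - r).choose (b - r) : ℝ) ≤ π ^ r * u.choose b := by
  induction r with
  | zero => simp
  | succ r ih =>
    have ih := ih (by omega)
    obtain ⟨v, rfl⟩ : ∃ v, u = v + 1 + r := ⟨u - r - 1, by omega⟩
    obtain ⟨c, rfl⟩ : ∃ c, b = c + 1 + r := ⟨b - r - 1, by omega⟩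
    rw [show v + 1 + r - r = v + 1 by omega, show c + 1 + r - r = c + 1 by omega] at ih
    rw [show v + 1 + r - (r + 1) = v by omega, show c + 1 + r - (r + 1) = c by omega]
    have h1 : ((v : ℝ) + 1) * v.choose c = (v + 1).choose (c + 1) * ((c : ℝ) + 1) := by
      exact_mod_cast Nat.add_one_mul_choose_eq v c
    have hv : (0 : ℝ) < (v : ℝ) + 1 := by positivity
    push_cast at hπ
    have hcv : (c : ℝ) ≤ v := by exact_mod_cast (by omega : c ≤ v)
    -- `(b - r) / (u - r) ≤ b / u ≤ π`
    have hπ0 : ((c : ℝ) + 1) ≤ π * (v + 1) := by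
      by_contra hlt
      have hr0 : (0 : ℝ) ≤ r := by positivity
      have h2 : π < 1 := by
        by_contra h2
        nlinarith
      nlinarith
    have hπpos : 0 ≤ π := by
      by_contra h2
      have : (0 : ℝ) ≤ c := by positivity
      nlinarith
    have h3 : (v.choose c : ℝ) ≤ π * (v + 1).choose (c + 1) := by
      have h4 : ((v : ℝ) + 1) * v.choose c ≤ (v + 1) * (π * (v + 1).choose (c + 1)) := by
        rw [h1]
        have : (0 : ℝ) ≤ (v + 1).choose (c + 1) := by positivity
        nlinarith
      exact le_of_mul_le_mul_left h4 hv
    calc (v.choose c : ℝ) ≤ π * (v + 1).choose (c + 1) := h3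
      _ ≤ π * (π ^ r * (v + 1 + r).choose (c + 1 + r)) := by gcongr
      _ = _ := by ring

theorem card_filter_subset_powersetCard_le {U R : Finset E} {b : ℕ} (hb : b ≤ U.card) {π : ℝ}
    (hπ0 : 0 ≤ π) (hπ : (b : ℝ) ≤ π * U.card) :
    (((U.powersetCard b).filter (R ⊆ ·)).card : ℝ) ≤ π ^ R.card * (U.powersetCard b).card := by
  have hnn : 0 ≤ π ^ R.card * ((U.powersetCard b).card : ℝ) := by positivity
  by_cases h : R ⊆ U ∧ R.card ≤ b
  · rw [Finset.card_filter_powersetCard_subset _ _ _ h.1 h.2, Finset.card_powersetCard]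
    exact choose_sub_le_pow_mul_choose hb hπ h.2
  · rw [Finset.filter_false_of_mem]
    · simpa using hnn
    · intro B hB hR
      rw [Finset.mem_powersetCard] at hB
      exact h ⟨hR.trans hB.1, hB.2 ▸ Finset.card_le_card hR⟩

/-- A random set is dominated, as far as this moment is concerned, by one that contains every element
independently with probability `π`. -/
theorem sum_pow_card_sdiff_le {U A : Finset E} {b : ℕ} (hb : b ≤ U.card) {π : ℝ}
    (hπ0 : 0 ≤ π) (hπ : (b : ℝ) ≤ π * U.card) {x : ℝ} (hx0 : 0 ≤ x) (hx1 : x ≤ 1) :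
    ∑ B ∈ U.powersetCard b, x ^ (A \ B).card ≤
      (1 - (1 - x) * (1 - π)) ^ A.card * (U.powersetCard b).card := by
  have expand : ∀ B : Finset E, x ^ (A \ B).card =
      ∑ R ∈ A.powerset, (if R ⊆ B then (1 - x) ^ R.card else 0) * x ^ (A.card - R.card) := by
    intro B
    have h1 : x ^ (A \ B).card = ∏ a ∈ A, ((if a ∈ B then 1 - x else 0) + x) := by
      rw [← Finset.prod_sdiff (Finset.inter_subset_left (s₁ := A) (s₂ := B)),
        Finset.prod_congr rfl (g := fun _ => (1 : ℝ)) (s₁ := A ∩ B) (fun a ha => by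
          simp [(Finset.mem_inter.1 ha).2]),
        Finset.prod_congr rfl (g := fun _ => x) (s₁ := A \ (A ∩ B)) (fun a ha => by
          have : a ∉ B := by simp at ha; tauto
          simp [this])]
      simp
    rw [h1, Finset.prod_add]
    refine Finset.sum_congr rfl fun R hR => ?_
    rw [Finset.mem_powerset] at hR
    rw [Finset.prod_const, Finset.card_sdiff_of_subset hR, Finset.prod_ite_zero]
    simp [Finset.subset_iff]
  calc ∑ B ∈ U.powersetCard b, x ^ (A \ B).card
      = ∑ R ∈ A.powerset, (1 - x) ^ R.card * x ^ (A.card - R.card) *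
          ((U.powersetCard b).filter (R ⊆ ·)).card := by
        simp_rw [expand]
        rw [Finset.sum_comm]
        refine Finset.sum_congr rfl fun R _ => ?_
        rw [← Finset.sum_mul, ← Finset.sum_filter, Finset.sum_const, nsmul_eq_mul]
        ring
    _ ≤ ∑ R ∈ A.powerset, (1 - x) ^ R.card * x ^ (A.card - R.card) *
          (π ^ R.card * (U.powersetCard b).card) := by
        refine Finset.sum_le_sum fun R _ => ?_
        have : 0 ≤ 1 - x := by linarith
        exact mul_le_mul_of_nonneg_left (card_filter_subset_powersetCard_le hb hπ0 hπ)
          (by positivity)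
    _ = (∑ R ∈ A.powerset, ((1 - x) * π) ^ R.card * x ^ (A.card - R.card)) *
          (U.powersetCard b).card := by
        rw [Finset.sum_mul]
        refine Finset.sum_congr rfl fun R _ => ?_
        rw [mul_pow]
        ring
    _ = _ := by
        rw [Finset.sum_pow_mul_eq_add_pow]
        congr 2
        ring

theorem tsum_bind_mul {α β : Type*} (p : PMF α) (f : α → PMF β) (g : β → ENNReal) :
    ∑' y, (p.bind f) y * g y = ∑' a, p a * ∑' y, f a y * g y := by
  simp_rw [PMF.bind_apply, ← ENNReal.tsum_mul_right, ← ENNReal.tsum_mul_left]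
  rw [ENNReal.tsum_comm]
  simp_rw [mul_assoc]

theorem tsum_map_uniformOfFinset_mul {α β : Type*} (s : Finset α) (hs : s.Nonempty) (f : α → β)
    (g : β → ENNReal) :
    ∑' y, ((PMF.uniformOfFinset s hs).map f) y * g y = (s.card : ENNReal)⁻¹ * ∑ a ∈ s, g (f a) := by
  classical
  rw [← PMF.bind_pure_comp, tsum_bind_mul]
  have h1 : ∀ a, ∑' y, ((PMF.pure ∘ f) a) y * g y = g (f a) := by
    intro a
    rw [tsum_eq_single (f a)]
    · simp
    · intro y hy
      simp [PMF.pure_apply, hy]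
  simp_rw [h1]
  rw [tsum_eq_sum (s := s) (fun a ha => by
    rw [PMF.uniformOfFinset_apply_of_notMem hs ha, zero_mul]), Finset.mul_sum]
  exact Finset.sum_congr rfl fun a ha => by rw [PMF.uniformOfFinset_apply_of_mem hs ha]

theorem card_claimed_le {X : Finset E} {b t : ℕ} {S : MakerStrategy X} {h : History E}
    (hh : h ∈ (play b S t).support) : (makerSet h ∪ breakerSet h).card ≤ (b + 1) * t := by
  induction t generalizing h with
  | zero =>
    rw [play, PMF.mem_support_pure_iff] at hh
    subst hh
    simp [makerSet, breakerSet]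
  | succ t ih =>
    obtain ⟨h, hh₀, B, hB, rfl⟩ := mem_support_play_succ hh
    have h1 := ih hh₀
    have h2 : B.card ≤ b := by
      rw [(Finset.mem_powersetCard.1 hB).2]
      exact min_le_left _ _
    have h3 : (S.move h B).toFinset.card ≤ 1 := by
      cases S.move h B <;> simp
    have h4 : makerSet (⟨B, S.move h B⟩ :: h) ∪ breakerSet (⟨B, S.move h B⟩ :: h) =
        ((S.move h B).toFinset ∪ B) ∪ (makerSet h ∪ breakerSet h) := by
      simp only [makerSet, breakerSet]
      exact Finset.union_union_union_comm _ _ _ _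
    rw [h4, mul_add, mul_one]
    have h5 := Finset.card_union_le ((S.move h B).toFinset ∪ B) (makerSet h ∪ breakerSet h)
    have h6 := Finset.card_union_le (S.move h B).toFinset B
    omega

/-- The potential `x ^ |A \ F|`, where `F` is the set of Breaker's elements, is controlled from round
to round: in each round `1 - x` shrinks by the factor `1 - π`, where `π` bounds the density of
Breaker's move among the unclaimed elements. Maker's moves do not matter, because Breaker never takes
the elements of `A` that Maker has claimed. -/
theorem tsum_play_mul_pow_le {X : Finset E} {b T : ℕ} (S : MakerStrategy X) {π : ℝ} (hπ0 : 0 ≤ π)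
    (hπ1 : π ≤ 1) (hπ : (b : ℝ) ≤ π * ((X.card : ℝ) - (b + 1) * T)) (A : Finset E) {t : ℕ}
    (ht : t ≤ T) {x : ℝ} (hx0 : 0 ≤ x) (hx1 : x ≤ 1) :
    ∑' h, play b S t h * ENNReal.ofReal (x ^ (A \ breakerSet h).card) ≤
      ENNReal.ofReal ((1 - (1 - x) * (1 - π) ^ t) ^ A.card) := by
  induction t generalizing x with
  | zero =>
    rw [tsum_eq_single []]
    · simp [play, breakerSet]
    · intro h hh
      simp [play, PMF.pure_apply, hh]
  | succ t ih =>
    have hx0' : 0 ≤ 1 - (1 - x) * (1 - π) := by nlinarith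
    have hx1' : 1 - (1 - x) * (1 - π) ≤ 1 := by nlinarith
    have ih := ih (by omega) hx0' hx1'
    rw [show 1 - (1 - (1 - (1 - x) * (1 - π))) * (1 - π) ^ t = 1 - (1 - x) * (1 - π) ^ (t + 1) by
      ring] at ih
    refine le_trans ?_ ih
    rw [play, tsum_bind_mul]
    refine ENNReal.tsum_le_tsum fun h => ?_
    by_cases hh : h ∈ (play b S t).support
    swap
    · rw [PMF.mem_support_iff, not_not] at hh
      simp [hh]
    refine mul_le_mul_right ?_ _
    rw [playRound, tsum_map_uniformOfFinset_mul]
    have hcard := card_claimed_le hh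
    have hU : (X.card : ℝ) - (b + 1) * T ≤ (unclaimed X h).card := by
      have h1 := Finset.le_card_sdiff (makerSet h ∪ breakerSet h) X
      have h2 : (b + 1) * t ≤ (b + 1) * T := Nat.mul_le_mul_left _ (by omega)
      have h3 : X.card ≤ (unclaimed X h).card + (b + 1) * T := by
        unfold unclaimed
        omega
      have h4 : (X.card : ℝ) ≤ (unclaimed X h).card + (b + 1) * T := by exact_mod_cast h3
      linarith
    have hmin : ((min b (unclaimed X h).card : ℕ) : ℝ) ≤ π * (unclaimed X h).card :=
      calc ((min b (unclaimed X h).card : ℕ) : ℝ) ≤ b := by exact_mod_cast min_le_left _ _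
        _ ≤ _ := hπ
        _ ≤ _ := mul_le_mul_of_nonneg_left hU hπ0
    have key := sum_pow_card_sdiff_le (A := A \ breakerSet h)
      (min_le_right b (unclaimed X h).card) hπ0 hmin hx0 hx1
    have hset : ∀ B : Finset E, A \ breakerSet (⟨B, S.move h B⟩ :: h) =
        (A \ breakerSet h) \ B := fun B => by
      rw [breakerSet, Finset.union_comm, Finset.sdiff_union_distrib, Finset.sdiff_sdiff_left']
    simp_rw [hset]
    rw [← ENNReal.ofReal_sum_of_nonneg (fun B _ => by positivity)]
    have hpos : (0 : ℝ) < (breakerMoves X b h).card := by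
      exact_mod_cast (breakerMoves_nonempty X b h).card_pos
    rw [← ENNReal.ofReal_natCast, ← ENNReal.ofReal_inv_of_pos hpos,
      ← ENNReal.ofReal_mul (by positivity)]
    refine ENNReal.ofReal_le_ofReal ?_
    rw [inv_mul_le_iff₀ hpos, mul_comm]
    exact key

/-- Whatever Maker does, Breaker claims all elements of `A` with probability at most `p ^ |A|`. -/
theorem prob_subset_breakerSet_le {X : Finset E} {b T : ℕ} (S : MakerStrategy X) {π p : ℝ}
    (hπ0 : 0 ≤ π) (hπ1 : π ≤ 1) (hπ : (b : ℝ) ≤ π * ((X.card : ℝ) - (b + 1) * T))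
    (hp : 1 - (1 - π) ^ T ≤ p) (A : Finset E) :
    (play b S T).toOuterMeasure {h | A ⊆ breakerSet h} ≤ ENNReal.ofReal (p ^ A.card) := by
  have h1 := tsum_play_mul_pow_le S hπ0 hπ1 hπ A le_rfl le_rfl zero_le_one
  have h2 : (1 - π) ^ T ≤ 1 := pow_le_one₀ (by linarith) (by linarith)
  refine le_trans ?_ (h1.trans (ENNReal.ofReal_le_ofReal (pow_le_pow_left₀ (by linarith)
    (by linarith) _)))
  rw [PMF.toOuterMeasure_apply]
  refine ENNReal.tsum_le_tsum fun h => ?_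
  by_cases hA : A ⊆ breakerSet h
  · simp [Finset.sdiff_eq_empty_iff_subset.2 hA, Set.indicator, hA]
  · simp [Set.indicator, hA]

theorem prob_exists_subset_breakerSet_le {X : Finset E} {b T m : ℕ} (S : MakerStrategy X) {π p : ℝ}
    (hπ0 : 0 ≤ π) (hπ1 : π ≤ 1) (hπ : (b : ℝ) ≤ π * ((X.card : ℝ) - (b + 1) * T))
    (hp : 1 - (1 - π) ^ T ≤ p) (hp1 : p ≤ 1) (𝒜 : Finset (Finset E)) (h𝒜 : ∀ A ∈ 𝒜, m ≤ A.card) :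
    (play b S T).toOuterMeasure {h | ∃ A ∈ 𝒜, A ⊆ breakerSet h} ≤
      ENNReal.ofReal (𝒜.card * p ^ m) := by
  have h2 : (1 - π) ^ T ≤ 1 := pow_le_one₀ (by linarith) (by linarith)
  have h3 : {h : History E | ∃ A ∈ 𝒜, A ⊆ breakerSet h} =
      ⋃ A ∈ 𝒜, {h : History E | A ⊆ breakerSet h} := by
    ext h; simp
  rw [h3]
  refine (MeasureTheory.measure_biUnion_finset_le _ _).trans ?_
  refine (Finset.sum_le_sum fun A hA => (prob_subset_breakerSet_le S hπ0 hπ1 hπ hp A).trans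
    (ENNReal.ofReal_le_ofReal (pow_le_pow_of_le_one (by linarith) hp1 (h𝒜 A hA)))).trans ?_
  rw [Finset.sum_const, nsmul_eq_mul, ENNReal.ofReal_mul (by positivity), ENNReal.ofReal_natCast]

end Probability

/-! ### Breaker's graph is robust with high probability -/

/-- Breaker's edges can fail to be robust only by containing one of a small number of large sets: all
edges between two disjoint sets of `k` vertices, or all but `2 * k` of the edges at some vertex. -/
theorem exists_obstructions {n k : ℕ} (hn : k ^ 2 + 2 * k + 1 ≤ n) :
    ∃ 𝒜 : Finset (Finset (Sym2 (Fin n))), 𝒜.card ≤ 2 * n ^ (2 * k + 1) ∧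
      (∀ A ∈ 𝒜, k ^ 2 ≤ A.card) ∧ ∀ F, (∀ A ∈ 𝒜, ¬ A ⊆ F) → Robust k F := by
  classical
  let 𝒦 := (Finset.univ : Finset (Fin n)).powersetCard k
  let 𝒜₁ : Finset (Finset (Sym2 (Fin n))) :=
    ((𝒦 ×ˢ 𝒦).filter fun XY => Disjoint XY.1 XY.2).image
      fun XY => (XY.1 ×ˢ XY.2).image fun xy => s(xy.1, xy.2)
  let 𝒜₂ : Finset (Finset (Sym2 (Fin n))) :=
    (Finset.univ : Finset (Fin n)).biUnion fun v =>
      ((Finset.univ.erase v).powersetCard (n - 1 - 2 * k)).image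
        fun R => R.image fun w => s(v, w)
  refine ⟨𝒜₁ ∪ 𝒜₂, ?_, ?_, ?_⟩
  · have h1 : 𝒜₁.card ≤ n ^ (2 * k) := by
      refine Finset.card_image_le.trans ((Finset.card_filter_le _ _).trans ?_)
      rw [Finset.card_product, Finset.card_powersetCard, Finset.card_univ, Fintype.card_fin,
        two_mul, pow_add]
      exact Nat.mul_le_mul (Nat.choose_le_pow n k) (Nat.choose_le_pow n k)
    have h2 : 𝒜₂.card ≤ n * n ^ (2 * k) := by
      refine Finset.card_biUnion_le.trans ?_
      refine (Finset.sum_le_card_nsmul _ _ (n ^ (2 * k)) fun v _ => ?_).trans (by simp)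
      refine Finset.card_image_le.trans ?_
      rw [Finset.card_powersetCard, Finset.card_erase_of_mem (Finset.mem_univ v),
        Finset.card_univ, Fintype.card_fin, Nat.choose_symm (by omega)]
      exact (Nat.choose_le_pow _ _).trans (Nat.pow_le_pow_left (by omega) _)
    have h3 : n ^ (2 * k) ≤ n * n ^ (2 * k) := Nat.le_mul_of_pos_left _ (by omega)
    have h4 := Finset.card_union_le 𝒜₁ 𝒜₂
    rw [pow_succ, mul_comm (n ^ (2 * k)) n]
    omega
  · intro A hA
    rcases Finset.mem_union.1 hA with hA | hA
    · obtain ⟨⟨X, Y⟩, hXY, rfl⟩ := Finset.mem_image.1 hA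
      rw [Finset.mem_filter, Finset.mem_product, Finset.mem_powersetCard,
        Finset.mem_powersetCard] at hXY
      obtain ⟨⟨⟨-, hX⟩, -, hY⟩, hd⟩ := hXY
      rw [Finset.card_image_of_injOn, Finset.card_product, hX, hY, sq]
      rintro ⟨x, y⟩ hxy ⟨x', y'⟩ hxy' e
      simp only [Finset.coe_product, Set.mem_prod, Finset.mem_coe] at hxy hxy' hd
      rcases Sym2.eq_iff.1 e with ⟨rfl, rfl⟩ | ⟨rfl, rfl⟩
      · rfl
      · exact absurd hxy'.2 (Finset.disjoint_left.1 hd hxy.1)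
    · obtain ⟨v, -, hA⟩ := Finset.mem_biUnion.1 hA
      obtain ⟨R, hR, rfl⟩ := Finset.mem_image.1 hA
      rw [Finset.mem_powersetCard] at hR
      rw [Finset.card_image_of_injective _ fun w w' h => Sym2.congr_right.1 h, hR.2]
      omega
  · intro F hF
    refine ⟨fun X Y hX hY hXY => ?_, fun v => ?_⟩
    · obtain ⟨X', hX', hXk⟩ := Finset.exists_subset_card_eq hX
      obtain ⟨Y', hY', hYk⟩ := Finset.exists_subset_card_eq hY
      by_contra! h
      refine hF ((X' ×ˢ Y').image fun xy => s(xy.1, xy.2)) (Finset.mem_union_left _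
        (Finset.mem_image.2 ⟨(X', Y'), ?_, rfl⟩)) ?_
      · simp only [Finset.mem_filter, Finset.mem_product, 𝒦, Finset.mem_powersetCard,
          Finset.subset_univ, true_and]
        exact ⟨⟨hXk, hYk⟩, Finset.disjoint_of_subset_left hX'
          (Finset.disjoint_of_subset_right hY' hXY)⟩
      · intro e he
        obtain ⟨⟨x, y⟩, hxy, rfl⟩ := Finset.mem_image.1 he
        rw [Finset.mem_product] at hxy
        exact h x (hX' hxy.1) y (hY' hxy.2)
    · by_contra! h
      have h1 := (Finset.univ.erase v).card_filter_add_card_filter_not (fun w => s(v, w) ∉ F)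
      rw [Finset.card_erase_of_mem (Finset.mem_univ v), Finset.card_univ, Fintype.card_fin] at h1
      have h2 : (Finset.univ.erase v).filter (fun w => s(v, w) ∉ F) =
          Finset.univ.filter fun w => w ≠ v ∧ s(v, w) ∉ F := by
        ext w; simp
      rw [h2] at h1
      obtain ⟨R, hR, hRk⟩ := Finset.exists_subset_card_eq (n := n - 1 - 2 * k)
        (s := (Finset.univ.erase v).filter fun w => ¬ s(v, w) ∉ F) (by omega)
      refine hF (R.image fun w => s(v, w)) (Finset.mem_union_right _ (Finset.mem_biUnion.2
        ⟨v, Finset.mem_univ v, Finset.mem_image.2 ⟨R, ?_, rfl⟩⟩)) ?_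
      · exact Finset.mem_powersetCard.2 ⟨hR.trans (Finset.filter_subset _ _), hRk⟩
      · intro e he
        obtain ⟨w, hw, rfl⟩ := Finset.mem_image.1 he
        simpa using (Finset.mem_filter.1 (hR hw)).2

theorem one_le_hamiltonProb_add {n k b : ℕ} (h3 : 3 ≤ n) (hn : k ^ 2 + 2 * k + 1 ≤ n) {π p : ℝ}
    (hπ0 : 0 ≤ π) (hπ1 : π ≤ 1)
    (hπ : (b : ℝ) ≤ π * (((board n).card : ℝ) - (b + 1) * budget n k))
    (hp : 1 - (1 - π) ^ budget n k ≤ p) (hp1 : p ≤ 1) :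
    1 ≤ hamiltonProb b (hamiltonStrategy n k) (budget n k) +
      ENNReal.ofReal (2 * n ^ (2 * k + 1) * p ^ k ^ 2) := by
  obtain ⟨𝒜, hcard, hlarge, hrob⟩ := exists_obstructions hn
  have hp0 : 0 ≤ p := by
    have : (1 - π) ^ budget n k ≤ 1 := pow_le_one₀ (by linarith) (by linarith)
    linarith
  set μ := (play b (hamiltonStrategy n k) (budget n k)).toOuterMeasure with hμ
  have huniv : μ Set.univ = 1 :=
    (PMF.toOuterMeasure_apply_eq_one_iff _ _).2 (Set.subset_univ _)
  have hbad := prob_exists_subset_breakerSet_le (hamiltonStrategy n k) hπ0 hπ1 hπ hp hp1 𝒜 hlarge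
  have hbound : ENNReal.ofReal (𝒜.card * p ^ k ^ 2) ≤
      ENNReal.ofReal (2 * n ^ (2 * k + 1) * p ^ k ^ 2) := by
    refine ENNReal.ofReal_le_ofReal (mul_le_mul_of_nonneg_right ?_ (by positivity))
    exact_mod_cast hcard
  calc 1 = μ Set.univ := huniv.symm
    _ ≤ μ ({h | (makerGraph h).IsHamiltonian} ∪ {h | ∃ A ∈ 𝒜, A ⊆ breakerSet h}) := by
      refine PMF.toOuterMeasure_mono _ fun h hh => ?_
      by_cases hA : ∃ A ∈ 𝒜, A ⊆ breakerSet h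
      · exact Or.inr hA
      · push Not at hA
        exact Or.inl (isHamiltonian_of_robust h3 hh.2 (hrob _ hA))
    _ ≤ _ := (MeasureTheory.measure_union_le _ _).trans
      (add_le_add le_rfl (hbad.trans hbound))

/-! ### Asymptotics -/

/-- The size of the vertex sets between which Maker finds edges: it grows faster than `log n`, and its
square is `o(n)`. -/
def scale (n : ℕ) : ℕ := n.sqrt.sqrt

theorem scale_sq_le (n : ℕ) : scale n ^ 2 ≤ n.sqrt := Nat.sqrt_le' _

theorem scale_pow_four_le (n : ℕ) : scale n ^ 4 ≤ n :=
  calc scale n ^ 4 = (scale n ^ 2) ^ 2 := by ring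
    _ ≤ n.sqrt ^ 2 := Nat.pow_le_pow_left (scale_sq_le n) 2
    _ ≤ n := Nat.sqrt_le' n

theorem le_scale_add_one_pow_four (n : ℕ) : n ≤ (scale n + 1) ^ 4 := by
  have h1 : n.sqrt + 1 ≤ (scale n + 1) ^ 2 := Nat.lt_succ_sqrt' _
  calc n ≤ (n.sqrt + 1) ^ 2 := (Nat.lt_succ_sqrt' n).le
    _ ≤ ((scale n + 1) ^ 2) ^ 2 := Nat.pow_le_pow_left h1 2
    _ = _ := by ring

theorem tendsto_scale : Tendsto scale atTop atTop := by
  refine tendsto_atTop.2 fun m => ?_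
  filter_upwards [eventually_ge_atTop (m ^ 4)] with n hn
  rw [scale, Nat.le_sqrt', Nat.le_sqrt']
  linarith [show (m ^ 2) ^ 2 = m ^ 4 by ring]

theorem tendsto_budget_div :
    Tendsto (fun n : ℕ => (budget n (scale n) : ℝ) / n) atTop (𝓝 1) := by
  have hupper : Tendsto (fun n : ℕ => 1 + 13 / √(n : ℝ) + 8 / (n : ℝ)) atTop (𝓝 1) := by
    have h1 : Tendsto (fun n : ℕ => 13 / √(n : ℝ)) atTop (𝓝 0) :=
      (Real.tendsto_sqrt_atTop.comp tendsto_natCast_atTop_atTop).const_div_atTop 13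
    have h2 : Tendsto (fun n : ℕ => 8 / (n : ℝ)) atTop (𝓝 0) :=
      tendsto_natCast_atTop_atTop.const_div_atTop 8
    simpa using (h1.const_add 1).add h2
  refine tendsto_of_tendsto_of_tendsto_of_le_of_le' tendsto_const_nhds hupper ?_ ?_
  · filter_upwards [eventually_gt_atTop 0] with n hn
    have hn' : (0 : ℝ) < n := by exact_mod_cast hn
    rw [le_div_iff₀ hn', one_mul]
    exact_mod_cast (by unfold budget; omega : n ≤ budget n (scale n))
  · filter_upwards [eventually_gt_atTop 0] with n hn
    have hn' : (0 : ℝ) < n := by exact_mod_cast hn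
    have hs : 0 < √(n : ℝ) := Real.sqrt_pos.2 hn'
    have h1 : (scale n : ℝ) ^ 2 ≤ √(n : ℝ) :=
      (by exact_mod_cast scale_sq_le n : (scale n : ℝ) ^ 2 ≤ n.sqrt).trans Real.nat_sqrt_le_real_sqrt
    have h2 : (budget n (scale n) : ℝ) ≤ n + 13 * √(n : ℝ) + 8 := by
      unfold budget
      push_cast
      nlinarith [sq_nonneg ((scale n : ℝ) - 1)]
    have h3 : 13 / √(n : ℝ) = 13 * √(n : ℝ) / n := by
      rw [div_eq_div_iff hs.ne' hn'.ne', mul_assoc, Real.mul_self_sqrt hn'.le]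
    rw [div_le_iff₀ hn', h3]
    calc (budget n (scale n) : ℝ) ≤ n + 13 * √(n : ℝ) + 8 := h2
      _ = _ := by field_simp

theorem exp_neg_le_one_sub_pow {x : ℝ} (hx0 : 0 ≤ x) (hx : x ≤ 1 / 2) (t : ℕ) :
    Real.exp (-(2 * x * t)) ≤ (1 - x) ^ t := by
  have h1 : Real.exp (-(2 * x)) ≤ 1 - x := by
    rw [Real.exp_neg, inv_le_comm₀ (Real.exp_pos _) (by linarith)]
    refine le_trans ?_ (Real.add_one_le_exp (2 * x))
    rw [inv_le_iff_one_le_mul₀ (by linarith)]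
    nlinarith
  calc Real.exp (-(2 * x * t)) = Real.exp (-(2 * x)) ^ t := by
        rw [← Real.exp_nat_mul]
        ring_nf
    _ ≤ _ := pow_le_pow_left₀ (Real.exp_pos _).le h1 t

/-- A bias of at most `(1 - ε) * n / 2` leaves a positive proportion of the edges unclaimed up to the end
of the budget, so that Breaker's moves have density `O(1 / n)` among the unclaimed edges. -/
theorem eventually_density_le {ε : ℝ} (hε : 0 < ε) (hε1 : ε ≤ 1) :
    ∀ᶠ n : ℕ in atTop, ∀ b : ℕ, (b : ℝ) ≤ (1 - ε) * n / 2 →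
      (b : ℝ) ≤ 4 / (ε * n) * (((board n).card : ℝ) - (b + 1) * budget n (scale n)) := by
  have hT := tendsto_budget_div.eventually_le_const (by linarith : (1 : ℝ) < 1 + ε / 4)
  filter_upwards [hT, eventually_ge_atTop ⌈8 / ε⌉₊, eventually_gt_atTop 0] with n hT hn hn0 b hb
  have hn0 : (0 : ℝ) < n := by exact_mod_cast hn0
  have hn : 8 ≤ ε * n := by
    have := (div_le_iff₀ hε).1 (Nat.ceil_le.1 hn)
    linarith
  rw [div_le_iff₀ hn0] at hT
  have hN : ((board n).card : ℝ) = n * (n - 1) / 2 := by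
    rw [board, SimpleGraph.card_edgeFinset_top_eq_card_choose_two, Fintype.card_fin,
      Nat.cast_choose_two]
  have hb0 : (0 : ℝ) ≤ b := by positivity
  have h1 : ((b : ℝ) + 1) * budget n (scale n) ≤ ((1 - ε) * n / 2 + 1) * ((1 + ε / 4) * n) :=
    mul_le_mul (by linarith) hT (by positivity) (by linarith)
  have h2 : ε * n ^ 2 / 8 ≤ ((board n).card : ℝ) - (b + 1) * budget n (scale n) := by
    rw [hN]
    have h3 : 8 * (n : ℝ) ≤ ε * n * n := mul_le_mul_of_nonneg_right hn hn0.le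
    have h4 : 0 ≤ ε ^ 2 * (n : ℝ) ^ 2 := by positivity
    have h5 : ε * (n : ℝ) ≤ 1 * n := mul_le_mul_of_nonneg_right hε1 hn0.le
    nlinarith
  calc (b : ℝ) ≤ n / 2 := by nlinarith
    _ = 4 / (ε * n) * (ε * n ^ 2 / 8) := by field_simp; norm_num
    _ ≤ _ := mul_le_mul_of_nonneg_left h2 (by positivity)

theorem tendsto_union_bound {p : ℝ} (hp0 : 0 ≤ p) (hp1 : p < 1) :
    Tendsto (fun n : ℕ => 2 * (n : ℝ) ^ (2 * scale n + 1) * p ^ scale n ^ 2) atTop (𝓝 0) := by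
  have h1 : Tendsto (fun k : ℕ => ((k + 1 : ℕ) : ℝ) ^ 12 * p ^ (k + 1)) atTop (𝓝 0) :=
    (tendsto_add_atTop_iff_nat (f := fun k : ℕ => (k : ℝ) ^ 12 * p ^ k) 1).2
      (tendsto_pow_const_mul_const_pow_of_abs_lt_one 12 (by rwa [abs_of_nonneg hp0]))
  have h2 : Tendsto (fun k : ℕ => ((k + 1 : ℕ) : ℝ) ^ 12 * p ^ k) atTop (𝓝 0) := by
    rcases hp0.eq_or_lt with rfl | hp
    · refine tendsto_const_nhds.congr' ?_
      filter_upwards [eventually_gt_atTop 0] with k hk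
      simp [hk.ne']
    · refine (by simpa using h1.const_mul p⁻¹ : Tendsto _ _ (𝓝 (0 : ℝ))).congr fun k => ?_
      rw [pow_succ p]
      push_cast
      field_simp
  have h3 : ∀ᶠ n : ℕ in atTop, ((scale n + 1 : ℕ) : ℝ) ^ 12 * p ^ scale n ≤ 1 / 2 :=
    (h2.comp tendsto_scale).eventually_le_const (by norm_num)
  have h4 : Tendsto (fun n : ℕ => 2 * (1 / 2 : ℝ) ^ scale n) atTop (𝓝 0) := by
    simpa using ((tendsto_pow_atTop_nhds_zero_of_lt_one (by norm_num : (0 : ℝ) ≤ 1 / 2)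
      (by norm_num)).comp tendsto_scale).const_mul 2
  refine squeeze_zero' (Eventually.of_forall fun n => by positivity) ?_ h4
  filter_upwards [h3, tendsto_scale.eventually_ge_atTop 1, eventually_ge_atTop 1] with n h3 hk hn
  have hn1 : (1 : ℝ) ≤ n := by exact_mod_cast hn
  have h5 : (n : ℝ) ^ 3 ≤ ((scale n + 1 : ℕ) : ℝ) ^ 12 := by
    have : n ^ 3 ≤ (scale n + 1) ^ 12 :=
      (Nat.pow_le_pow_left (le_scale_add_one_pow_four n) 3).trans_eq (by ring)
    exact_mod_cast this
  have h6 : (n : ℝ) ^ 3 * p ^ scale n ≤ 1 / 2 :=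
    (mul_le_mul_of_nonneg_right h5 (by positivity)).trans h3
  rw [mul_assoc]
  refine mul_le_mul_of_nonneg_left ?_ (by norm_num)
  calc (n : ℝ) ^ (2 * scale n + 1) * p ^ scale n ^ 2
      ≤ (n : ℝ) ^ (3 * scale n) * p ^ scale n ^ 2 := by
        gcongr
        omega
    _ = ((n : ℝ) ^ 3 * p ^ scale n) ^ scale n := by
        rw [mul_pow, ← pow_mul, ← pow_mul, sq]
    _ ≤ _ := pow_le_pow_left₀ (by positivity) h6 _

end RandomBreaker

theorem theorem1 (ε : ℝ) (hε : 0 < ε) :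
    ∃ T : ℕ → ℕ, Tendsto (fun n : ℕ => (T n : ℝ) / (n : ℝ)) atTop (𝓝 1) ∧
      ∃ S : (n b : ℕ) → RandomBreaker.MakerStrategy (RandomBreaker.board n),
        ∀ b : ℕ → ℕ, (∀ n : ℕ, (b n : ℝ) ≤ (1 - ε) * (n : ℝ) / 2) →
          Tendsto (fun n : ℕ => RandomBreaker.hamiltonProb (b n) (S n (b n)) (T n))
            atTop (𝓝 1) := by
  open RandomBreaker in
  refine ⟨fun n => budget n (scale n), tendsto_budget_div,
    fun n _ => hamiltonStrategy n (scale n), fun b hb => ?_⟩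
  -- a larger `ε` only restricts the bias further
  wlog hε1 : ε ≤ 1 generalizing ε
  · refine this 1 one_pos (fun n => (hb n).trans ?_) le_rfl
    have : (0 : ℝ) ≤ n := by positivity
    nlinarith [not_le.1 hε1]
  set p : ℝ := 1 - Real.exp (-(16 / ε)) with hp
  have hp1 : p < 1 := by
    have := Real.exp_pos (-(16 / ε))
    linarith
  have hp0 : 0 ≤ p := by
    have : Real.exp (-(16 / ε)) ≤ 1 := Real.exp_le_one_iff.2 (by rw [neg_nonpos]; positivity)
    linarith
  have hlim : Tendsto (fun n : ℕ => 1 - ENNReal.ofReal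
      (2 * (n : ℝ) ^ (2 * scale n + 1) * p ^ scale n ^ 2)) atTop (𝓝 1) := by
    have h := ENNReal.tendsto_ofReal (tendsto_union_bound hp0 hp1)
    rw [ENNReal.ofReal_zero] at h
    simpa using ENNReal.Tendsto.sub (tendsto_const_nhds (x := (1 : ENNReal))) h
      (Or.inl ENNReal.one_ne_top)
  refine tendsto_of_tendsto_of_tendsto_of_le_of_le' hlim tendsto_const_nhds ?_
    (Eventually.of_forall fun n => ?_)
  · have hT := tendsto_budget_div.eventually_le_const (by norm_num : (1 : ℝ) < 2)
    filter_upwards [hT, eventually_density_le hε hε1, eventually_ge_atTop ⌈8 / ε⌉₊,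
      eventually_ge_atTop 3, tendsto_scale.eventually_ge_atTop 2] with n hT hdens hn h3 hk
    have hn0 : (0 : ℝ) < n := by exact_mod_cast (by omega : 0 < n)
    have hn : 8 ≤ ε * n := by
      have := (div_le_iff₀ hε).1 (Nat.ceil_le.1 hn)
      linarith
    rw [div_le_iff₀ hn0] at hT
    have hπ2 : 4 / (ε * n) ≤ 1 / 2 := by
      rw [div_le_iff₀ (by positivity)]
      linarith
    have hsq : scale n ^ 2 + 2 * scale n + 1 ≤ n := by
      refine le_trans ?_ (scale_pow_four_le n)
      nlinarith [Nat.mul_le_mul hk hk, Nat.mul_le_mul (Nat.mul_le_mul hk hk) (le_refl (scale n ^ 2))]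
    refine tsub_le_iff_right.2 (one_le_hamiltonProb_add h3 hsq (π := 4 / (ε * n)) (by positivity)
      (by linarith) (hdens _ (hb n)) ?_ hp1.le)
    have h1 := exp_neg_le_one_sub_pow (by positivity) hπ2 (budget n (scale n))
    have h2 : Real.exp (-(16 / ε)) ≤
        Real.exp (-(2 * (4 / (ε * n)) * budget n (scale n))) := by
      refine Real.exp_le_exp.2 (neg_le_neg ?_)
      calc 2 * (4 / (ε * n)) * (budget n (scale n) : ℝ) ≤ 2 * (4 / (ε * n)) * (2 * n) := by
            gcongr
        _ = 16 / ε := by field_simp; norm_num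
    linarith
  · exact (PMF.toOuterMeasure_mono _ (Set.subset_univ _)).trans
      ((PMF.toOuterMeasure_apply_eq_one_iff _ _).2 (Set.subset_univ _)).le
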